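/- Let $q$ be a power of an odd prime and $n=q+1$. Assume that $\alpha\in\mathbb F_q^{*}$ is an element of order $r\ge 2$, where $q-1=rk$ with $k$ even. Then for every integer $i$ with $2\le i\le \frac n2-2$ there exists an MDS convolutional code over $\mathbb F_q$ with parameters $(n,\,n-2i+1,\,2;\,1,\,2i+2)_q$. Here a polynomial matrix $G(D)=(g_{ab})\in\mathbb F_q[D]^{\kappa\times n}$ is called basic if it has a polynomial right inverse. Put $\gamma_a=\max_b\deg g_{ab}$ (zero entries contribute $0$). A basic matrix is called reduced if $\gamma=\sum_a\gamma_a$ is smallest among all basic matrices generating the same code. A convolutional code with parameters $(n,\kappa,\gamma;m,d_f)_q$ is a submodule $C=\{u(D)G(D): u(D)\in\mathbb F_q[D]^{\kappa}\}$ of $\mathbb F_q[D]^n$, where $G(D)\in\mathbb F_q[D]^{\kappa\times n}$ is a reduced basic matrix with $\sum_a\gamma_a=\gamma$ and $\max_a\gamma_a=m$, and where $d_f$ is the minimum weight of a nonzero element of $C$ (the weight of $v(D)\in\mathbb F_q[D]^n$ being the total number of nonzero coefficients of its entries). It is MDS if it attains the generalized Singleton bound, that is, $d_f=(n-\kappa)\left(\lfloor\gamma/\kappa\rfloor+1\right)+\gamma+1$.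 -/

import Mathlib

open Polynomial

namespace ConvCode

variable {F : Type*} [Field F] {k n : ℕ}

/-- The submodule `{u(D) G(D) | u(D) ∈ F[D]^k}` of `F[D]^n` generated by the rows of `G(D)`. -/
noncomputable def code (G : Matrix (Fin k) (Fin n) F[X]) : Submodule F[X] (Fin n → F[X]) :=
  LinearMap.range G.vecMulLinear

/-- A polynomial matrix is basic if it has a polynomial right inverse. -/
def IsBasic (G : Matrix (Fin k) (Fin n) F[X]) : Prop :=
  ∃ R : Matrix (Fin n) (Fin k) F[X], G * R = 1

/-- The `i`-th constraint length `γ_i = max_j deg g_ij` (a zero entry contributes `0`). -/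
def constraintLength (G : Matrix (Fin k) (Fin n) F[X]) (i : Fin k) : ℕ :=
  Finset.univ.sup fun j => (G i j).natDegree

/-- The overall constraint length `γ = ∑ γ_i`. -/
def overallConstraintLength (G : Matrix (Fin k) (Fin n) F[X]) : ℕ :=
  ∑ i, constraintLength G i

/-- The memory `m = max γ_i`. -/
def memory (G : Matrix (Fin k) (Fin n) F[X]) : ℕ :=
  Finset.univ.sup fun i => constraintLength G i

/-- A basic matrix is reduced if its overall constraint length is the smallest among all basic
generator matrices of the same code. -/
def IsReducedBasic (G : Matrix (Fin k) (Fin n) F[X]) : Prop :=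
  IsBasic G ∧ ∀ G' : Matrix (Fin k) (Fin n) F[X], IsBasic G' → code G' = code G →
    overallConstraintLength G ≤ overallConstraintLength G'

/-- The weight of `v(D) ∈ F[D]^n`: the total number of nonzero coefficients of its entries. -/
def weight (v : Fin n → F[X]) : ℕ :=
  ∑ j, (v j).support.card

/-- `d` is the free distance of `C`: the minimum weight of a nonzero codeword. -/
def IsFreeDistance (C : Submodule F[X] (Fin n → F[X])) (d : ℕ) : Prop :=
  IsLeast {w | ∃ v ∈ C, v ≠ 0 ∧ weight v = w} d

/-- `C` is a convolutional code with parameters `(n, k, γ; m, d)` over `F`: it is generated by a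
reduced basic `k × n` matrix with overall constraint length `γ` (the degree of the code) and
memory `m`, and its free distance is `d`. -/
def HasParameters (C : Submodule F[X] (Fin n → F[X])) (k γ m d : ℕ) : Prop :=
  (∃ G : Matrix (Fin k) (Fin n) F[X], IsReducedBasic G ∧ C = code G ∧
    overallConstraintLength G = γ ∧ memory G = m) ∧ IsFreeDistance C d

/-- `C` is maximum-distance-separable: its parameters attain the generalized Singleton bound
`d ≤ (n - k) (⌊γ / k⌋ + 1) + γ + 1`. (A code with a nonzero codeword has `1 ≤ k ≤ n`, so the
subtraction and the division are the genuine ones.) -/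
def IsMDS (C : Submodule F[X] (Fin n → F[X])) : Prop :=
  ∃ k γ m d : ℕ, HasParameters C k γ m d ∧ d = (n - k) * (γ / k + 1) + γ + 1

end ConvCode

/-!
The code is built from its parity check. Index the `n = q + 1` coordinates by the points of the
projective line over `F`, and read polynomials of degree at most `2 i` as binary forms of that
degree, to be evaluated at these points. Any nonzero vector orthogonal to all forms of degree `d`
has weight at least `d + 2` (`le_hammingNorm_of_evalPairing_eq_zero`): this is the MDS property of
extended Reed–Solomon codes.

Since `q` is odd there is a monic quadratic `Q` without roots. Let `A` be the system of the `2 i - 1`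
checks by `Q, Q X, …, Q X ^ (2 i - 2)`, let `c` consist of the two checks by `1` and `X`, and let `J`
place `c` next to the first two checks of `A`. The convolutional code is the kernel of
`A + D (J ∘ c)`.

* *Generator matrix* (`exists_unitMemory_code`). A basis of `K = ker A ⊓ ker c`, which has dimension
  `n - 2 i - 1`, gives constant rows, and two more rows `e - D f` complete a basic generator matrix
  of degree `2` and memory `1`. It is reduced: the constant codewords are exactly those in `K`, and a
  basic generator matrix of degree less than `2` would have too many independent constant rows
  (`le_overallConstraintLength`).
* *Free distance* (`le_weight_of_mem_parityCode`). The lowest coefficient of a codeword is killed by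
  `A`, and so has weight at least `2 i`, because `Q` vanishes at no point of the projective line and
  the multiples of `Q` are equivalent to all forms of degree `2 i - 2`. The highest coefficient is
  killed by `c` and by the check `Q X ^ (2 i - 2)`, and so has weight at least `2`, because `1` and
  `Q X ^ (2 i - 2)` have no common zero. If the two coefficients coincide, the coefficient is
  orthogonal to all forms of degree `2 i`, and has weight at least `2 i + 2`. Counting dimensions on
  `2 i + 2` coordinates gives a constant codeword of exactly this weight.
-/

namespace ConvCode

/-! ### Coefficient vectors and unit-memory parity checks -/

section General

variable {F : Type*} [Field F] {n : ℕ}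

/-- The vector of coefficients of `D ^ t` of a polynomial vector. -/
noncomputable def coeffVec (t : ℕ) : (Fin n → F[X]) →ₗ[F] (Fin n → F) :=
  (Polynomial.lcoeff F t).compLeft (Fin n)

/-- A vector over `F`, regarded as a constant polynomial vector. -/
noncomputable def constVec : (Fin n → F) →ₗ[F] (Fin n → F[X]) :=
  (Polynomial.monomial 0).compLeft (Fin n)

theorem coeffVec_apply (t : ℕ) (v : Fin n → F[X]) (j : Fin n) :
    coeffVec t v j = (v j).coeff t := rfl

theorem constVec_apply (x : Fin n → F) (j : Fin n) : constVec x j = C (x j) := by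
  rw [← monomial_zero_left]
  rfl

theorem coeffVec_zero_constVec (x : Fin n → F) : coeffVec 0 (constVec x) = x := by
  ext j
  simp [coeffVec_apply, constVec_apply]

theorem coeffVec_succ_constVec (t : ℕ) (x : Fin n → F) :
    coeffVec (t + 1) (constVec x) = 0 := by
  ext j
  simp [coeffVec_apply, constVec_apply, coeff_C_succ]

theorem coeffVec_zero_X_smul (v : Fin n → F[X]) : coeffVec 0 ((X : F[X]) • v) = 0 := by
  ext j
  simp [coeffVec_apply]

theorem coeffVec_succ_X_smul (t : ℕ) (v : Fin n → F[X]) :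
    coeffVec (t + 1) ((X : F[X]) • v) = coeffVec t v := by
  ext j
  simp [coeffVec_apply]

theorem coeffVec_C_smul (t : ℕ) (a : F) (v : Fin n → F[X]) :
    coeffVec t ((C a : F[X]) • v) = a • coeffVec t v := by
  ext j
  simp [coeffVec_apply]

variable {W : Type*} [AddCommGroup W] [Module F W]

/-- The polynomial vectors annihilated by the parity check `A + D B`, whose constant and linear
parts are linear maps over `F`; the condition is written out coefficient by coefficient. -/
def parityCode (A B : (Fin n → F) →ₗ[F] W) : Submodule F[X] (Fin n → F[X]) where
  carrier := {v | A (coeffVec 0 v) = 0 ∧ ∀ t, A (coeffVec (t + 1) v) + B (coeffVec t v) = 0}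
  zero_mem' := by simp
  add_mem' := by
    rintro v w ⟨hv, hv'⟩ ⟨hw, hw'⟩
    refine ⟨by simp [hv, hw], fun t => ?_⟩
    have := congrArg₂ (· + ·) (hv' t) (hw' t)
    simp only [map_add, add_zero] at this ⊢
    rw [← this]
    abel
  smul_mem' := by
    intro p v hv
    induction p using Polynomial.induction_on' generalizing v with
    | add p q hp hq =>
      obtain ⟨h1, h1'⟩ := hp hv
      obtain ⟨h2, h2'⟩ := hq hv
      refine ⟨by simp [add_smul, h1, h2], fun t => ?_⟩
      have := congrArg₂ (· + ·) (h1' t) (h2' t)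
      simp only [add_smul, map_add, add_zero] at this ⊢
      rw [← this]
      abel
    | monomial m a =>
      induction m generalizing v with
      | zero =>
        obtain ⟨h1, h1'⟩ := hv
        rw [monomial_zero_left]
        refine ⟨by simp [coeffVec_C_smul, h1], fun t => ?_⟩
        rw [coeffVec_C_smul, coeffVec_C_smul, map_smul, map_smul, ← smul_add, h1', smul_zero]
      | succ m ih =>
        rw [← monomial_mul_X, mul_smul]
        refine ih ⟨by simp [coeffVec_zero_X_smul], fun t => ?_⟩
        rw [coeffVec_succ_X_smul]
        cases t with
        | zero => simp [coeffVec_zero_X_smul, hv.1]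
        | succ t => rw [coeffVec_succ_X_smul]; exact hv.2 t

/-! ### Basic matrices and the overall constraint length -/

theorem linearIndependent_rows_of_mul_eq_one {R : Type*} [CommRing R] {k : ℕ}
    {M : Matrix (Fin k) (Fin n) R} {N : Matrix (Fin n) (Fin k) R} (h : M * N = 1) :
    LinearIndependent R M.row := by
  rw [← Matrix.vecMul_injective_iff]
  intro x y hxy
  have := congrArg (fun z => Matrix.vecMul z N) hxy
  simpa [Matrix.vecMul_vecMul, h] using this

theorem exists_mul_eq_one_of_linearIndependent_rows {ι : Type*} [Fintype ι] [DecidableEq ι]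
    {M : Matrix ι (Fin n) F} (h : LinearIndependent F M.row) :
    ∃ N : Matrix (Fin n) ι F, M * N = 1 := by
  rw [← Matrix.vecMul_injective_iff] at h
  obtain ⟨g, hg⟩ := M.vecMulLinear.exists_leftInverse_of_injective (LinearMap.ker_eq_bot.2 h)
  refine ⟨Matrix.of fun x b => g (Pi.single x 1) b, ?_⟩
  ext a b
  have h1 : g (M a) = Pi.single a 1 := by
    have := LinearMap.congr_fun hg (Pi.single a 1)
    simpa [Matrix.row] using this
  rw [Matrix.mul_apply, Matrix.one_eq_pi_single, ← h1]
  conv_rhs => rw [pi_eq_sum_univ' (M a)]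
  simp

/-- If the constant codewords span at most `m` dimensions, then a generator matrix with `m + u`
rows has overall constraint length at least `u`: otherwise more than `m` of its rows are constant,
and the rows of a basic matrix stay independent after `D = 0`. -/
theorem le_overallConstraintLength {m u : ℕ} {G : Matrix (Fin (m + u)) (Fin n) F[X]}
    (hG : IsBasic G) (K : Submodule F (Fin n → F)) (hK : Module.finrank F K = m)
    (h : ∀ x, constVec x ∈ code G → x ∈ K) : u ≤ overallConstraintLength G := by
  by_contra! hlt
  obtain ⟨R, hR⟩ := hG
  let Z := Finset.univ.filter fun i => constraintLength G i = 0
  have hZ : m < Z.card := by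
    have h1 : (Finset.univ.filter fun i => ¬ constraintLength G i = 0).card ≤
        overallConstraintLength G := by
      rw [Finset.card_filter]
      refine Finset.sum_le_sum fun i _ => ?_
      split_ifs <;> omega
    have h2 := Finset.card_filter_add_card_filter_not (s := (Finset.univ : Finset (Fin (m + u))))
      (fun i => constraintLength G i = 0)
    rw [Finset.card_univ, Fintype.card_fin] at h2
    change m < (Finset.univ.filter fun i => constraintLength G i = 0).card
    omega
  have hconst : ∀ i ∈ Z, constVec (coeffVec 0 (G i)) = G i := by
    intro i hi
    ext1 j
    rw [constVec_apply, coeffVec_apply]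
    refine (eq_C_of_natDegree_eq_zero ?_).symm
    have h0 : constraintLength G i = 0 := (Finset.mem_filter.1 hi).2
    have h1 : (G i j).natDegree ≤ constraintLength G i :=
      Finset.le_sup (f := fun j => (G i j).natDegree) (Finset.mem_univ j)
    omega
  have hmem : ∀ i : Z, coeffVec 0 (G i) ∈ K := by
    rintro ⟨i, hi⟩
    refine h _ ?_
    rw [hconst i hi, code, range_vecMulLinear]
    exact Submodule.subset_span ⟨i, rfl⟩
  have hli : LinearIndependent F (G.map constantCoeff).row := by
    refine linearIndependent_rows_of_mul_eq_one (N := R.map constantCoeff) ?_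
    rw [← Matrix.map_mul, hR, Matrix.map_one _ (map_zero _) (map_one _)]
  have hli' : LinearIndependent F fun i : Z => (⟨coeffVec 0 (G i), hmem i⟩ : K) := by
    refine LinearIndependent.of_comp K.subtype ?_
    exact hli.comp (fun i : Z => (i : Fin (m + u))) Subtype.val_injective
  have := hli'.fintype_card_le_finrank
  rw [hK, Fintype.card_coe] at this
  omega

/-! ### Generator matrices of memory one -/

/-- The matrix whose first `m` rows are the constant vectors `w j` and whose last `u` rows are
`e l - D f l`. -/
noncomputable def unitMemoryGenerator {m u : ℕ} (w : Fin m → Fin n → F) (e f : Fin u → Fin n → F) :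
    Matrix (Fin (m + u)) (Fin n) F[X] :=
  Matrix.of (Fin.append (fun j => constVec (w j))
    (fun l => constVec (e l) - (X : F[X]) • constVec (f l)))

section Generator

variable {m u : ℕ} (w : Fin m → Fin n → F) (e f : Fin u → Fin n → F)

theorem unitMemoryGenerator_castAdd (j : Fin m) :
    unitMemoryGenerator w e f (Fin.castAdd u j) = constVec (w j) := by
  ext1 x
  rw [unitMemoryGenerator, Matrix.of_apply, Fin.append_left]

theorem unitMemoryGenerator_natAdd (l : Fin u) :
    unitMemoryGenerator w e f (Fin.natAdd m l) =
      constVec (e l) - (X : F[X]) • constVec (f l) := by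
  ext1 x
  rw [unitMemoryGenerator, Matrix.of_apply, Fin.append_right]

theorem constraintLength_castAdd (j : Fin m) :
    constraintLength (unitMemoryGenerator w e f) (Fin.castAdd u j) = 0 := by
  rw [constraintLength, ← bot_eq_zero, Finset.sup_eq_bot_iff]
  intro x _
  rw [unitMemoryGenerator_castAdd, constVec_apply, natDegree_C, bot_eq_zero]

theorem constraintLength_natAdd (hf : ∀ l, f l ≠ 0) (l : Fin u) :
    constraintLength (unitMemoryGenerator w e f) (Fin.natAdd m l) = 1 := by
  have key : ∀ x, unitMemoryGenerator w e f (Fin.natAdd m l) x = C (-f l x) * X + C (e l x) := by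
    intro x
    rw [unitMemoryGenerator_natAdd]
    simp only [Pi.sub_apply, Pi.smul_apply, constVec_apply, smul_eq_mul, C_neg]
    ring
  rw [constraintLength]
  refine le_antisymm (Finset.sup_le fun x _ => ?_) ?_
  · rw [key]
    exact natDegree_linear_le
  · obtain ⟨x, hx⟩ := Function.ne_iff.1 (hf l)
    refine le_trans ?_ (Finset.le_sup (Finset.mem_univ x))
    rw [key, natDegree_linear (neg_ne_zero.2 hx)]

theorem overallConstraintLength_unitMemoryGenerator (hf : ∀ l, f l ≠ 0) :
    overallConstraintLength (unitMemoryGenerator w e f) = u := by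
  simp [overallConstraintLength, Fin.sum_univ_add, constraintLength_castAdd,
    constraintLength_natAdd w e f hf]

theorem memory_unitMemoryGenerator (hf : ∀ l, f l ≠ 0) (hu : 0 < u) :
    memory (unitMemoryGenerator w e f) = 1 := by
  rw [memory]
  refine le_antisymm (Finset.sup_le fun i _ => ?_) ?_
  · induction i using Fin.addCases with
    | left j => simp [constraintLength_castAdd]
    | right l => simp [constraintLength_natAdd w e f hf]
  · rw [← constraintLength_natAdd w e f hf ⟨0, hu⟩]
    exact Finset.le_sup (f := fun i => constraintLength (unitMemoryGenerator w e f) i)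
      (Finset.mem_univ _)

/-- A constant right inverse is supplied by functionals dual to `w` and `e` that vanish
on `f`. -/
theorem isBasic_unitMemoryGenerator
    (h : LinearIndependent F (Sum.elim (Sum.elim w e) f)) :
    IsBasic (unitMemoryGenerator w e f) := by
  obtain ⟨N, hN⟩ := exists_mul_eq_one_of_linearIndependent_rows
    (M := Matrix.of (Sum.elim (Sum.elim w e) f)) h
  have hN' : ∀ a b, ∑ x, Sum.elim (Sum.elim w e) f a x * N x b = if a = b then 1 else 0 := by
    intro a b
    have := congrFun (congrFun hN a) b
    rwa [Matrix.mul_apply, Matrix.one_apply] at this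
  refine ⟨Matrix.of fun x i => C (N x (Sum.inl (finSumFinEquiv.symm i))), ?_⟩
  ext1 i b
  obtain ⟨b, rfl⟩ := finSumFinEquiv.surjective b
  rw [Matrix.mul_apply, Matrix.one_apply]
  simp only [Matrix.of_apply, Equiv.symm_apply_apply]
  induction i using Fin.addCases with
  | left j =>
    have h1 := congrArg C (hN' (Sum.inl (Sum.inl j)) (Sum.inl b))
    rw [unitMemoryGenerator_castAdd, ← finSumFinEquiv_apply_left]
    simp only [constVec_apply, EmbeddingLike.apply_eq_iff_eq]
    simpa [apply_ite C] using h1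
  | right l =>
    have h1 := congrArg C (hN' (Sum.inl (Sum.inr l)) (Sum.inl b))
    have h2 := congrArg C (hN' (Sum.inr l) (Sum.inl b))
    simp only [Sum.elim_inl, Sum.elim_inr, map_sum, C_mul, reduceCtorEq, if_false, C_0,
      apply_ite C, C_1, Sum.inl.injEq] at h1 h2
    rw [unitMemoryGenerator_natAdd, ← finSumFinEquiv_apply_right]
    simp only [Pi.sub_apply, Pi.smul_apply, smul_eq_mul, constVec_apply, sub_mul, mul_assoc,
      EmbeddingLike.apply_eq_iff_eq, Finset.sum_sub_distrib, ← Finset.mul_sum, h1, h2, mul_zero,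
      sub_zero]

end Generator

/-- The code with parity check `A + D (J ∘ c)`, where `J` is injective and `v ↦ (A v, c v)` is onto,
has a reduced basic generator matrix of memory `1` and overall constraint length `u`. Only the
inclusion of the code in `parityCode A (J ∘ₗ c)` is stated; together with the presence of all
constant words of `ker A ⊓ ker c` it determines the free distance in the application. -/
theorem exists_unitMemory_code [FiniteDimensional F W] {m u : ℕ} (hu : 0 < u)
    (A : (Fin n → F) →ₗ[F] W) (c : (Fin n → F) →ₗ[F] (Fin u → F)) (J : (Fin u → F) →ₗ[F] W)
    (hJ : Function.Injective J) (hsurj : Function.Surjective (A.prod c))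
    (hm : m + Module.finrank F W + u = n) :
    ∃ G : Matrix (Fin (m + u)) (Fin n) F[X], IsReducedBasic G ∧
      overallConstraintLength G = u ∧ memory G = 1 ∧ code G ≤ parityCode A (J ∘ₗ c) ∧
      ∀ x, A x = 0 → c x = 0 → constVec x ∈ code G := by
  let K := LinearMap.ker (A.prod c)
  have hK : Module.finrank F K = m := by
    have h1 := LinearMap.finrank_range_add_finrank_ker (A.prod c)
    rw [LinearMap.range_eq_top.2 hsurj, finrank_top] at h1
    simp only [Module.finrank_prod, Module.finrank_fin_fun] at h1
    change Module.finrank F (LinearMap.ker (A.prod c)) = m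
    omega
  obtain ⟨S, hS⟩ := (A.prod c).exists_rightInverse_of_surjective (LinearMap.range_eq_top.2 hsurj)
  have hAS : ∀ p, A (S p) = p.1 := fun p => congrArg Prod.fst (LinearMap.congr_fun hS p)
  have hcS : ∀ p, c (S p) = p.2 := fun p => congrArg Prod.snd (LinearMap.congr_fun hS p)
  let bK : Module.Basis (Fin m) F K := Module.finBasisOfFinrankEq F K hK
  let bU : Module.Basis (Fin u) F (Fin u → F) := Pi.basisFun F (Fin u)
  -- The rows solve the parity check: `A (e l) = 0`, `J (c (e l)) = J (bU l) = A (f l)` and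
  -- `c (f l) = 0`, so `(A + D (J ∘ c)) (e l - D f l) = 0`.
  let w : Fin m → Fin n → F := fun j => bK j
  let e : Fin u → Fin n → F := fun l => S (0, bU l)
  let f : Fin u → Fin n → F := fun l => S (J (bU l), 0)
  have hAw : ∀ j, A (w j) = 0 := fun j => congrArg Prod.fst (LinearMap.mem_ker.1 (bK j).2)
  have hcw : ∀ j, c (w j) = 0 := fun j => congrArg Prod.snd (LinearMap.mem_ker.1 (bK j).2)
  have hli : LinearIndependent F (Sum.elim (Sum.elim w e) f) := by
    rw [Fintype.linearIndependent_iff]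
    intro g hg
    simp only [Fintype.sum_sum_type, Sum.elim_inl, Sum.elim_inr] at hg
    have hA := congrArg A hg
    have hc := congrArg c hg
    simp only [map_add, map_sum, map_smul, hAw, hcw, e, f, hAS, hcS, smul_zero,
      Finset.sum_const_zero, zero_add, add_zero, map_zero] at hA hc
    have g2 := Fintype.linearIndependent_iff.1 bU.linearIndependent _ hc
    have g3 := Fintype.linearIndependent_iff.1
      (bU.linearIndependent.map' J (LinearMap.ker_eq_bot.2 hJ)) _ hA
    simp only [g2, g3, zero_smul, Finset.sum_const_zero, add_zero] at hg
    have g1 := Fintype.linearIndependent_iff.1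
      (bK.linearIndependent.map' K.subtype (Submodule.ker_subtype K)) _ hg
    rintro ((j | l) | l)
    exacts [g1 j, g2 l, g3 l]
  have hf : ∀ l, f l ≠ 0 := fun l => hli.ne_zero (Sum.inr l)
  have hcode : code (unitMemoryGenerator w e f) ≤ parityCode A (J ∘ₗ c) := by
    rw [code, range_vecMulLinear, Submodule.span_le]
    rintro _ ⟨i, rfl⟩
    rw [SetLike.mem_coe, Matrix.row]
    induction i using Fin.addCases with
    | left j =>
      rw [unitMemoryGenerator_castAdd]
      refine ⟨by rw [coeffVec_zero_constVec, hAw], fun t => ?_⟩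
      cases t with
      | zero => simp [coeffVec_zero_constVec, coeffVec_succ_constVec, hcw]
      | succ t => simp [coeffVec_succ_constVec]
    | right l =>
      rw [unitMemoryGenerator_natAdd]
      refine ⟨by simp [coeffVec_zero_constVec, coeffVec_zero_X_smul, e, hAS], fun t => ?_⟩
      match t with
      | 0 => simp [coeffVec_zero_constVec, coeffVec_succ_constVec, coeffVec_succ_X_smul,
          coeffVec_zero_X_smul, e, f, hAS, hcS]
      | 1 => simp [coeffVec_zero_constVec, coeffVec_succ_constVec, coeffVec_succ_X_smul, f, hcS]
      | t + 2 => simp [coeffVec_succ_constVec, coeffVec_succ_X_smul]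
  refine ⟨unitMemoryGenerator w e f, ⟨isBasic_unitMemoryGenerator w e f hli, ?_⟩,
    overallConstraintLength_unitMemoryGenerator w e f hf,
    memory_unitMemoryGenerator w e f hf hu, hcode, ?_⟩
  · -- A constant codeword `x` satisfies `A x = 0` and `J (c x) = 0`, hence lies in `K`.
    intro G' hG' hGG'
    rw [overallConstraintLength_unitMemoryGenerator w e f hf]
    refine le_overallConstraintLength hG' K hK fun x hx => ?_
    obtain ⟨h0, h1⟩ := hcode (hGG' ▸ hx)
    have h2 := h1 0
    rw [coeffVec_zero_constVec] at h0 h2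
    rw [coeffVec_succ_constVec, map_zero, zero_add] at h2
    exact LinearMap.mem_ker.2 (Prod.ext h0 (hJ (by simpa using h2)))
  · intro x hA hc
    have hx : x ∈ K := LinearMap.mem_ker.2 (Prod.ext hA hc)
    have hsum : constVec x = ∑ j, (C (bK.repr ⟨x, hx⟩ j) : F[X]) • constVec (w j) := by
      have h1 := congrArg (constVec ∘ₗ K.subtype) (bK.sum_repr ⟨x, hx⟩)
      simp only [map_sum, map_smul, LinearMap.comp_apply, Submodule.subtype_apply] at h1
      rw [← h1]
      refine Finset.sum_congr rfl fun j _ => ?_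
      ext1 y
      simp [w, smul_eq_C_mul]
    rw [hsum, code, range_vecMulLinear]
    refine Submodule.sum_mem _ fun j _ => Submodule.smul_mem _ _ (Submodule.subset_span ?_)
    exact ⟨Fin.castAdd u j, unitMemoryGenerator_castAdd w e f j⟩

end General

/-! ### The weight of a codeword -/

section Weight

variable {F : Type*} [Field F] {n : ℕ} {W U : Type*} [AddCommGroup W] [Module F W]
  [AddCommGroup U] [Module F U]

open Classical in
theorem hammingNorm_coeffVec_add_le_weight {s t : ℕ} (hst : s ≠ t) (v : Fin n → F[X]) :
    hammingNorm (coeffVec s v) + hammingNorm (coeffVec t v) ≤ weight v := by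
  rw [hammingNorm, hammingNorm, Finset.card_filter, Finset.card_filter,
    ← Finset.sum_add_distrib, weight]
  refine Finset.sum_le_sum fun j _ => ?_
  have h : ((({s, t} : Finset ℕ)).filter fun m => (v j).coeff m ≠ 0).card ≤
      (v j).support.card := by
    refine Finset.card_le_card fun m hm => ?_
    exact mem_support_iff.2 (Finset.mem_filter.1 hm).2
  rwa [Finset.card_filter, Finset.sum_pair hst] at h

open Classical in
theorem hammingNorm_coeffVec_le_weight (t : ℕ) (v : Fin n → F[X]) :
    hammingNorm (coeffVec t v) ≤ weight v :=
  (Nat.le_add_right _ _).trans (hammingNorm_coeffVec_add_le_weight (Nat.succ_ne_self t).symm v)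

open Classical in
theorem weight_constVec (x : Fin n → F) : weight (constVec x) = hammingNorm x := by
  rw [weight, hammingNorm, Finset.card_filter]
  refine Finset.sum_congr rfl fun j _ => ?_
  rw [constVec_apply]
  split_ifs with h
  · rw [support_C h, Finset.card_singleton]
  · rw [not_not.1 h, C_0, support_zero, Finset.card_empty]

open Classical in
/-- The lowest coefficient of a codeword is annihilated by `A`, the highest one by `c` and, modulo
the range of `J`, by `A`; if they coincide, both `A` and `c` annihilate it. -/
theorem le_weight_of_mem_parityCode {A : (Fin n → F) →ₗ[F] W} {c : (Fin n → F) →ₗ[F] U}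
    {J : U →ₗ[F] W} (hJ : Function.Injective J) {d d' : ℕ}
    (h_both : ∀ x, x ≠ 0 → A x = 0 → c x = 0 → d ≤ hammingNorm x)
    (h_low : ∀ x, x ≠ 0 → A x = 0 → d ≤ hammingNorm x + d')
    (h_high : ∀ x, x ≠ 0 → A x ∈ LinearMap.range J → c x = 0 → d' ≤ hammingNorm x)
    {v : Fin n → F[X]} (hv : v ∈ parityCode A (J ∘ₗ c)) (hv0 : v ≠ 0) : d ≤ weight v := by
  obtain ⟨hA0, hA⟩ := hv
  have hex : ∃ t, coeffVec t v ≠ 0 := by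
    by_contra! h
    refine hv0 (funext fun j => Polynomial.ext fun t => ?_)
    exact congrFun (h t) j
  let N := Finset.univ.sup fun j => (v j).natDegree
  have hN : ∀ t, coeffVec t v ≠ 0 → t ≤ N := by
    intro t ht
    obtain ⟨j, hj⟩ := Function.ne_iff.1 ht
    exact (le_natDegree_of_ne_zero hj).trans
      (Finset.le_sup (f := fun j => (v j).natDegree) (Finset.mem_univ j))
  let s := Nat.find hex
  let e := Nat.findGreatest (fun t => coeffVec t v ≠ 0) N
  have hs : coeffVec s v ≠ 0 := Nat.find_spec hex
  have he : coeffVec e v ≠ 0 :=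
    Nat.findGreatest_spec (P := fun t => coeffVec t v ≠ 0) (hN s hs) hs
  have hAs : A (coeffVec s v) = 0 := by
    rcases hs' : s with _ | t
    · exact hA0
    · have h0 : coeffVec t v = 0 := not_not.1 (Nat.find_min hex (m := t) (by omega))
      simpa [h0] using hA t
  have hce : c (coeffVec e v) = 0 := by
    have h0 : coeffVec (e + 1) v = 0 := by
      by_contra h0
      have : e + 1 ≤ e := Nat.le_findGreatest (hN _ h0) h0
      omega
    have h1 := hA e
    rw [h0, map_zero, zero_add] at h1
    exact hJ (by simpa using h1)
  have hAe : A (coeffVec e v) ∈ LinearMap.range J := by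
    rcases e with _ | t
    · rw [hA0]
      exact zero_mem _
    · rw [eq_neg_of_add_eq_zero_left (hA t)]
      exact neg_mem ⟨_, rfl⟩
  rcases eq_or_ne s e with hse | hse
  · rw [← hse] at hce
    exact (h_both _ hs hAs hce).trans (hammingNorm_coeffVec_le_weight s v)
  · have h1 := h_low _ hs hAs
    have h2 := h_high _ he hAe hce
    have h3 := hammingNorm_coeffVec_add_le_weight hse v
    omega

end Weight

/-! ### Evaluation on the projective line -/

section ProjectiveLine

variable {F : Type*} [Field F]

/-- The value of a polynomial of degree at most `d` at a point of the projective line, with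
`none` as the point at infinity: the polynomial is read as a binary form of degree `d`. -/
noncomputable def projEval (d : ℕ) : Option F → F[X] →ₗ[F] F
  | none => lcoeff F d
  | some a => leval a

@[simp]
theorem projEval_none (d : ℕ) (p : F[X]) : projEval d (none : Option F) p = p.coeff d := rfl

@[simp]
theorem projEval_some (d : ℕ) (a : F) (p : F[X]) : projEval d (some a) p = p.eval a := rfl

theorem projEval_mul {d e : ℕ} {p q : F[X]} (hp : p.natDegree ≤ d) (hq : q.natDegree ≤ e)
    (x : Option F) : projEval (d + e) x (p * q) = projEval d x p * projEval e x q := by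
  cases x with
  | none => exact coeff_mul_add_eq_of_natDegree_le hp hq
  | some a => exact eval_mul

variable {n : ℕ} (ε : Fin n → Option F)

/-- The pairing of a polynomial, read as a form of degree `d` and evaluated at the points `ε j` of
the projective line, with a vector. -/
noncomputable def evalPairing (d : ℕ) : F[X] →ₗ[F] (Fin n → F) →ₗ[F] F :=
  LinearMap.mk₂ F (fun p v => ∑ j, projEval d (ε j) p * v j)
    (fun p q v => by simp [add_mul, Finset.sum_add_distrib])
    (fun a p v => by simp [mul_assoc, Finset.mul_sum])
    (fun p v w => by simp [mul_add, Finset.sum_add_distrib])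
    (fun a p v => by simp [mul_left_comm, Finset.mul_sum])

theorem evalPairing_apply (d : ℕ) (p : F[X]) (v : Fin n → F) :
    evalPairing ε d p v = ∑ j, projEval d (ε j) p * v j := rfl

theorem evalPairing_mul {d e : ℕ} {p q : F[X]} (hp : p.natDegree ≤ d) (hq : q.natDegree ≤ e)
    (v : Fin n → F) : evalPairing ε (d + e) (p * q) v =
      evalPairing ε e q fun j => projEval d (ε j) p * v j := by
  simp only [evalPairing_apply, projEval_mul hp hq]
  exact Finset.sum_congr rfl fun j _ => by ring

open Classical in
theorem evalPairing_single (d : ℕ) (p : F[X]) (j : Fin n) (a : F) :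
    evalPairing ε d p (Pi.single j a) = projEval d (ε j) p * a := by
  rw [evalPairing_apply, Finset.sum_eq_single j]
  · rw [Pi.single_eq_same]
  · intro b _ hb
    rw [Pi.single_eq_of_ne hb, mul_zero]
  · exact fun h => absurd (Finset.mem_univ j) h

variable {ε}

open Classical in
/-- The minimum distance of the dual of an extended Reed–Solomon code: if the support had at most
`d + 1` points, then a form of degree `d` would vanish at all but one of them. -/
theorem le_hammingNorm_of_evalPairing_eq_zero (hε : Function.Injective ε) {d : ℕ} {v : Fin n → F}
    (hv : v ≠ 0) (h : ∀ p : F[X], p.natDegree ≤ d → evalPairing ε d p v = 0) :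
    d + 2 ≤ hammingNorm v := by
  by_contra! hlt
  let S : Finset (Fin n) := Finset.univ.filter fun j => v j ≠ 0
  have hS : S.card ≤ d + 1 := Nat.le_of_lt_succ hlt
  have hmem : ∀ j, j ∈ S ↔ v j ≠ 0 := fun j => by simp [S]
  suffices ∃ p : F[X], p.natDegree ≤ d ∧ ∃ j₀ ∈ S, projEval d (ε j₀) p ≠ 0 ∧
      ∀ j ∈ S.erase j₀, projEval d (ε j) p = 0 by
    obtain ⟨p, hp, j₀, hj₀, hp₀, hp'⟩ := this
    have h1 := h p hp
    rw [evalPairing_apply, Finset.sum_eq_single j₀] at h1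
    · exact mul_ne_zero hp₀ ((hmem j₀).1 hj₀) h1
    · intro j _ hj
      by_cases hj' : v j = 0
      · rw [hj', mul_zero]
      · rw [hp' j (Finset.mem_erase.2 ⟨hj, (hmem j).2 hj'⟩), zero_mul]
    · exact fun h => absurd (Finset.mem_univ _) h
  have hcard : ∀ j ∈ S, (S.erase j).card ≤ d := fun j hj => by
    rw [Finset.card_erase_of_mem hj]
    omega
  -- A coordinate at infinity, if there is one in the support, is the one to be isolated.
  obtain ⟨j₀, hj₀, hfin⟩ : ∃ j₀ ∈ S, ∀ j ∈ S.erase j₀, ε j ≠ none := by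
    by_cases hinf : ∃ j₀ ∈ S, ε j₀ = none
    · obtain ⟨j₀, hj₀, hn⟩ := hinf
      refine ⟨j₀, hj₀, fun j hj hjn => (Finset.mem_erase.1 hj).1 (hε (hjn.trans hn.symm))⟩
    · push Not at hinf
      obtain ⟨j₀, hj₀⟩ := Function.ne_iff.1 hv
      exact ⟨j₀, (hmem j₀).2 hj₀, fun j hj => hinf j (Finset.mem_of_mem_erase hj)⟩
  let P : F[X] := ∏ j ∈ S.erase j₀, (X - C ((ε j).getD 0))
  have hPdeg : P.natDegree = (S.erase j₀).card := by
    rw [natDegree_prod_of_monic _ _ fun j _ => monic_X_sub_C _]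
    simp
  have hPmonic : P.Monic := monic_prod_of_monic _ _ fun j _ => monic_X_sub_C _
  have hP : ∀ j ∈ S.erase j₀, ∃ a, ε j = some a ∧ P.eval a = 0 := by
    intro j hj
    obtain ⟨a, ha⟩ := Option.ne_none_iff_exists'.1 (hfin j hj)
    refine ⟨a, ha, ?_⟩
    rw [eval_prod]
    exact Finset.prod_eq_zero hj (by simp [ha])
  cases hj : ε j₀ with
  | none =>
    have hQ : (P * X ^ (d - (S.erase j₀).card)).natDegree = d := by
      rw [hPmonic.natDegree_mul (monic_X_pow _), hPdeg, natDegree_X_pow]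
      have := hcard j₀ hj₀
      omega
    refine ⟨P * X ^ (d - (S.erase j₀).card), hQ.le, j₀, hj₀, ?_, fun j hj' => ?_⟩
    · have h1 := hPmonic.mul (monic_X_pow (d - (S.erase j₀).card))
      rw [Monic, leadingCoeff, hQ] at h1
      rw [hj, projEval_none, h1]
      exact one_ne_zero
    · obtain ⟨a, ha, h0⟩ := hP j hj'
      rw [ha, projEval_some, eval_mul, h0, zero_mul]
  | some b =>
    refine ⟨P, hPdeg.le.trans (hcard j₀ hj₀), j₀, hj₀, ?_, fun j hj' => ?_⟩
    · rw [hj, projEval_some, eval_prod, Finset.prod_ne_zero_iff]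
      intro j hj'
      obtain ⟨a, ha⟩ := Option.ne_none_iff_exists'.1 (hfin j hj')
      rw [ha, Option.getD_some, eval_sub, eval_X, eval_C, sub_ne_zero]
      rintro rfl
      exact (Finset.mem_erase.1 hj').1 (hε (ha.trans hj.symm))
    · obtain ⟨a, ha, h0⟩ := hP j hj'
      rw [ha, projEval_some, h0]

end ProjectiveLine

/-! ### The parity checks from extended Reed–Solomon codes -/

section ReedSolomon

variable {F : Type*} [Field F] {n : ℕ} (ε : Fin n → Option F) (Q : F[X]) (t : ℕ)

/-- The pairings with `Q, Q X, …, Q X ^ t`, read as forms of degree `t + 2`. -/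
noncomputable def multipleCheck : (Fin n → F) →ₗ[F] (Fin (t + 1) → F) :=
  LinearMap.pi fun j => evalPairing ε (2 + t) (Q * X ^ (j : ℕ))

/-- The pairings with `1` and `X`, read as forms of degree `t + 2`. -/
noncomputable def lowCheck : (Fin n → F) →ₗ[F] (Fin 2 → F) :=
  LinearMap.pi fun j => evalPairing ε (2 + t) (X ^ (j : ℕ))

variable {ε Q t}

theorem evalPairing_eq_zero_of_multipleCheck {v : Fin n → F} (h : multipleCheck ε Q t v = 0)
    {g : F[X]} (hg : g.natDegree ≤ t) : evalPairing ε (2 + t) (Q * g) v = 0 := by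
  rw [g.as_sum_range_C_mul_X_pow' (Nat.lt_succ_of_le hg), Finset.mul_sum, map_sum,
    LinearMap.sum_apply]
  refine Finset.sum_eq_zero fun j hj => ?_
  rw [mul_left_comm, ← smul_eq_C_mul, map_smul, LinearMap.smul_apply]
  have h1 : evalPairing ε (2 + t) (Q * X ^ j) v = 0 := congrFun h ⟨j, Finset.mem_range.1 hj⟩
  rw [h1, smul_zero]

/-- Division by `Q` writes a form of degree `t + 2` through the two sets of checks. -/
theorem evalPairing_eq_zero_of_checks (hQ : Q.Monic) (hQ2 : Q.natDegree = 2) {v : Fin n → F}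
    (h : multipleCheck ε Q t v = 0) (h' : lowCheck ε t v = 0) {p : F[X]}
    (hp : p.natDegree ≤ 2 + t) : evalPairing ε (2 + t) p v = 0 := by
  have hr : (p %ₘ Q).natDegree < 2 := hQ2 ▸ natDegree_modByMonic_lt p hQ (by
    rintro rfl
    simp at hQ2)
  rw [← modByMonic_add_div p Q, map_add, LinearMap.add_apply,
    evalPairing_eq_zero_of_multipleCheck h (by rw [natDegree_divByMonic p hQ, hQ2]; omega),
    add_zero, (p %ₘ Q).as_sum_range_C_mul_X_pow' hr, map_sum, LinearMap.sum_apply]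
  refine Finset.sum_eq_zero fun j hj => ?_
  rw [← smul_eq_C_mul, map_smul, LinearMap.smul_apply]
  have h1 : evalPairing ε (2 + t) (X ^ j) v = 0 := congrFun h' ⟨j, Finset.mem_range.1 hj⟩
  rw [h1, smul_zero]

open Classical in
theorem le_hammingNorm_of_checks (hε : Function.Injective ε) (hQ : Q.Monic)
    (hQ2 : Q.natDegree = 2) {v : Fin n → F} (hv : v ≠ 0) (h : multipleCheck ε Q t v = 0)
    (h' : lowCheck ε t v = 0) : t + 4 ≤ hammingNorm v := by
  have := le_hammingNorm_of_evalPairing_eq_zero hε hv (d := 2 + t)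
    fun p hp => evalPairing_eq_zero_of_checks hQ hQ2 h h' hp
  omega

theorem projEval_ne_zero (hQ : Q.Monic) (hQ2 : Q.natDegree = 2) (hroot : ∀ a, Q.eval a ≠ 0)
    (x : Option F) : projEval 2 x Q ≠ 0 := by
  cases x with
  | none =>
    rw [projEval_none, ← hQ2, hQ.coeff_natDegree]
    exact one_ne_zero
  | some a => exact hroot a

open Classical in
/-- As `Q` vanishes nowhere on the projective line, scaling the coordinates by its values turns the
multiples of `Q` into all forms of degree `t`. -/
theorem le_hammingNorm_of_multipleCheck (hε : Function.Injective ε) (hQ : Q.Monic)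
    (hQ2 : Q.natDegree = 2) (hroot : ∀ a, Q.eval a ≠ 0) {v : Fin n → F} (hv : v ≠ 0)
    (h : multipleCheck ε Q t v = 0) : t + 2 ≤ hammingNorm v := by
  have hw : ∀ j, projEval 2 (ε j) Q ≠ 0 := fun j => projEval_ne_zero hQ hQ2 hroot _
  have hnorm : hammingNorm (fun j => projEval 2 (ε j) Q * v j) = hammingNorm v := by
    simp [hammingNorm, hw]
  rw [← hnorm]
  refine le_hammingNorm_of_evalPairing_eq_zero hε ?_ fun p hp => ?_
  · rw [← hammingNorm_ne_zero_iff, hnorm, hammingNorm_ne_zero_iff]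
    exact hv
  · rw [← evalPairing_mul ε hQ2.le hp]
    exact evalPairing_eq_zero_of_multipleCheck h hp

open Classical in
/-- No point of the projective line is a common zero of `1` and `Q X ^ t`, as forms of degree
`t + 2`: the latter does not vanish at infinity. -/
theorem two_le_hammingNorm (hQ : Q.Monic) (hQ2 : Q.natDegree = 2) {v : Fin n → F} (hv : v ≠ 0)
    (h : multipleCheck ε Q t v (Fin.last t) = 0) (h' : lowCheck ε t v = 0) :
    2 ≤ hammingNorm v := by
  by_contra! hlt
  obtain ⟨j, hj⟩ := Function.ne_iff.1 hv
  have hsingle : v = Pi.single j (v j) := by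
    ext b
    rcases eq_or_ne b j with rfl | hb
    · rw [Pi.single_eq_same]
    · rw [Pi.single_eq_of_ne hb]
      by_contra hvb
      refine hb (Finset.card_le_one.1 (Nat.le_of_lt_succ hlt) b ?_ j ?_) <;>
        simpa using by assumption
  have h1 : evalPairing ε (2 + t) (X ^ 0) v = 0 := congrFun h' 0
  have h2 : evalPairing ε (2 + t) (Q * X ^ t) v = 0 := h
  rw [hsingle, evalPairing_single] at h1 h2
  replace h1 := (mul_eq_zero.1 h1).resolve_right hj
  replace h2 := (mul_eq_zero.1 h2).resolve_right hj
  cases hx : ε j with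
  | none =>
    rw [hx, projEval_none, coeff_mul_add_eq_of_natDegree_le hQ2.le (natDegree_X_pow_le t),
      coeff_X_pow_self, mul_one, ← hQ2, hQ.coeff_natDegree] at h2
    exact one_ne_zero h2
  | some a =>
    rw [hx, projEval_some, pow_zero, eval_one] at h1
    exact one_ne_zero h1

open Classical in
/-- Vectors supported on the first `m` coordinates have weight at most `m`. -/
theorem hammingNorm_extendByZero_le {m : ℕ} (hmn : m ≤ n) (y : Fin m → F) :
    hammingNorm (Function.ExtendByZero.linearMap F (Fin.castLE hmn) y) ≤ m := by
  have hsub : (Finset.univ.filter fun j =>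
      Function.ExtendByZero.linearMap F (Fin.castLE hmn) y j ≠ 0) ⊆
      Finset.univ.image (Fin.castLE hmn) := by
    intro j hj
    by_contra hj'
    refine (Finset.mem_filter.1 hj).2 (Function.extend_apply' _ _ _ ?_)
    rintro ⟨b, rfl⟩
    exact hj' (Finset.mem_image_of_mem _ (Finset.mem_univ b))
  exact (Finset.card_le_card hsub).trans (Finset.card_image_le.trans (by simp))

theorem extendByZero_ne_zero {m : ℕ} (hmn : m ≤ n) {y : Fin m → F} (hy : y ≠ 0) :
    Function.ExtendByZero.linearMap F (Fin.castLE hmn) y ≠ 0 := by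
  obtain ⟨b, hb⟩ := Function.ne_iff.1 hy
  refine Function.ne_iff.2 ⟨Fin.castLE hmn b, ?_⟩
  simpa [(Fin.castLE_injective hmn).extend_apply] using hb

/-- The checks are already onto on vectors supported on `t + 3` coordinates: they are injective
there by the minimum distance, and the dimensions agree. -/
theorem surjective_checks (hε : Function.Injective ε) (hQ : Q.Monic) (hQ2 : Q.natDegree = 2)
    (hn : t + 3 ≤ n) :
    Function.Surjective ((multipleCheck ε Q t).prod (lowCheck ε t)) := by
  classical
  let E := Function.ExtendByZero.linearMap F (Fin.castLE hn)
  have hinj : Function.Injective (((multipleCheck ε Q t).prod (lowCheck ε t)) ∘ₗ E) := by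
    rw [← LinearMap.ker_eq_bot, LinearMap.ker_eq_bot']
    intro y hy
    by_contra hy0
    have h1 := le_hammingNorm_of_checks hε hQ hQ2 (extendByZero_ne_zero hn hy0)
      (congrArg Prod.fst hy) (congrArg Prod.snd hy)
    have h2 := hammingNorm_extendByZero_le hn y
    omega
  have hsurj := (LinearMap.injective_iff_surjective_of_finrank_eq_finrank (by simp)).1 hinj
  exact Function.Surjective.of_comp hsurj

open Classical in
theorem exists_hammingNorm_eq (hε : Function.Injective ε) (hQ : Q.Monic) (hQ2 : Q.natDegree = 2)
    (hn : t + 4 ≤ n) : ∃ x : Fin n → F, x ≠ 0 ∧ multipleCheck ε Q t x = 0 ∧ lowCheck ε t x = 0 ∧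
      hammingNorm x = t + 4 := by
  let E := Function.ExtendByZero.linearMap F (Fin.castLE hn)
  have hker : LinearMap.ker (((multipleCheck ε Q t).prod (lowCheck ε t)) ∘ₗ E) ≠ ⊥ :=
    LinearMap.ker_ne_bot_of_finrank_lt (by simp)
  obtain ⟨y, hy, hy0⟩ := Submodule.exists_mem_ne_zero_of_ne_bot hker
  have h1 := extendByZero_ne_zero hn hy0
  refine ⟨E y, h1, congrArg Prod.fst hy, congrArg Prod.snd hy, le_antisymm ?_ ?_⟩
  · exact hammingNorm_extendByZero_le hn y
  · exact le_hammingNorm_of_checks hε hQ hQ2 h1 (congrArg Prod.fst hy) (congrArg Prod.snd hy)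

/-- With a root-free quadratic `Q`, the parity check with rows `Q + D`, `Q X + D X` and `Q X ^ j`,
`2 ≤ j ≤ t`, evaluated at `n` points of the projective line, defines a code of memory `1`, degree
`2` and free distance `t + 4`. -/
theorem exists_hasParameters (hε : Function.Injective ε) (hQ : Q.Monic) (hQ2 : Q.natDegree = 2)
    (hroot : ∀ a, Q.eval a ≠ 0) (ht : 2 ≤ t) {m : ℕ} (hm : m + t + 3 = n) (hn : t + 4 ≤ n) :
    ∃ C : Submodule F[X] (Fin n → F[X]), HasParameters C (m + 2) 2 1 (t + 4) := by
  classical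
  let J : (Fin 2 → F) →ₗ[F] (Fin (t + 1) → F) :=
    Function.ExtendByZero.linearMap F (Fin.castLE (by omega))
  have hJ : Function.Injective J := by
    rw [← LinearMap.ker_eq_bot, LinearMap.ker_eq_bot']
    intro y hy
    by_contra hy0
    exact extendByZero_ne_zero _ hy0 hy
  -- `J` fills the coordinates `0` and `1` only, and `2 ≤ t`.
  have hJlast : ∀ y ∈ LinearMap.range J, y (Fin.last t) = 0 := by
    rintro _ ⟨y, rfl⟩
    refine Function.extend_apply' _ _ _ ?_
    rintro ⟨b, hb⟩
    have := congrArg Fin.val hb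
    simp only [Fin.val_castLE, Fin.val_last] at this
    omega
  obtain ⟨G, hG, hγ, hmem, hle, hconst⟩ := exists_unitMemory_code (m := m) two_pos
    (multipleCheck ε Q t) (lowCheck ε t) J hJ (surjective_checks hε hQ hQ2 (by omega))
    (by rw [Module.finrank_fin_fun]; omega)
  refine ⟨code G, ⟨G, hG, rfl, hγ, hmem⟩, ?_, ?_⟩
  · obtain ⟨x, hx0, hA, hc, hx⟩ := exists_hammingNorm_eq hε hQ hQ2 hn
    refine ⟨constVec x, hconst x hA hc, fun h0 => hx0 ?_, by rw [weight_constVec, hx]⟩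
    rw [← coeffVec_zero_constVec x, h0, map_zero]
  · rintro _ ⟨v, hv, hv0, rfl⟩
    refine le_weight_of_mem_parityCode hJ (d' := 2) ?_ ?_ ?_ (hle hv) hv0
    · exact fun x hx hA hc => le_hammingNorm_of_checks hε hQ hQ2 hx hA hc
    · intro x hx hA
      have := le_hammingNorm_of_multipleCheck hε hQ hQ2 hroot hx hA
      omega
    · exact fun x hx hA hc => two_le_hammingNorm hQ hQ2 hx (hJlast _ hA) hc

end ReedSolomon

end ConvCode

theorem mainTheorem6 {F : Type*} [Field F] [Fintype F] (q n r k : ℕ)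
    (hcard : Fintype.card F = q) (hodd : Odd q) (hn : n = q + 1)
    (α : Fˣ) (hα : orderOf α = r) (hr : 2 ≤ r) (hk : q - 1 = r * k) (hke : Even k)
    (i : ℕ) (hi : 2 ≤ i) (hi' : i ≤ n / 2 - 2) :
    ∃ C : Submodule (Polynomial F) (Fin n → Polynomial F),
      ConvCode.HasParameters C (n - 2 * i + 1) 2 1 (2 * i + 2) ∧ ConvCode.IsMDS C := by
  have hchar : ringChar F ≠ 2 := by
    rw [Ne, FiniteField.even_card_iff_char_two, hcard, Nat.odd_iff.1 hodd]
    exact one_ne_zero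
  obtain ⟨a, ha⟩ := FiniteField.exists_nonsquare hchar
  have hroot : ∀ b, (X ^ 2 - C a : F[X]).eval b ≠ 0 := by
    intro b hb
    refine ha ⟨b, ?_⟩
    rw [eval_sub, eval_pow, eval_X, eval_C, sub_eq_zero] at hb
    rw [← hb, sq]
  have hcardn : Fintype.card (Option F) = n := by rw [Fintype.card_option, hcard, hn]
  obtain ⟨C, hC⟩ := ConvCode.exists_hasParameters (t := 2 * i - 2) (m := n - 2 * i - 1)
    (Fintype.equivFinOfCardEq hcardn).symm.injective
    (monic_X_pow_sub_C a two_ne_zero) (natDegree_X_pow_sub_C) hroot (by omega) (by omega) (by omega)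
  have h1 : n - 2 * i - 1 + 2 = n - 2 * i + 1 := by omega
  have h2 : 2 * i - 2 + 4 = 2 * i + 2 := by omega
  rw [h1, h2] at hC
  refine ⟨C, hC, _, _, _, _, hC, ?_⟩
  -- The dimension `n - 2 * i + 1` exceeds the degree `2`, so the quotient in the bound is `0`.
  rw [Nat.div_eq_of_lt (by omega)]
  omega
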